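/- **Conventions.** All groups are abelian; $\tilde G=\mathbb{Q}\otimes G$ is the divisible hull of a torsion-free group $G$. A torsion-free group $G$ of finite rank is *almost completely decomposable* if it has a subgroup of finite index which is completely decomposable (a direct sum of finitely many torsion-free groups of rank 1). Its *regulator* $A=\mathrm{Reg}\,G$ is the intersection of all completely decomposable subgroups of least index; $A$ is completely decomposable. For a type $\tau$, $A_\tau=\mathrm{Reg}_\tau G$ is the sum of the rank-one summands of type $\tau$ in a fixed decomposition of $A$ into rank-one summands, and $T=T(G)=\{\tau\mid A_\tau\neq 0\}$. $G$ is *block-rigid* if the types in $T$ are pairwise incomparable, *rigid* if moreover every $A_\tau$ ($\tau\in T$) has rank 1, *of ring type* if all types in $T$ are idempotent, and a *CRQ-group* if $G/A$ is cyclic. $\mathcal{A}_0$ is the class of block-rigid almost completely decomposable CRQ-groups of ring type. For an idempotent type $\tau$, $P_\infty(\tau)$ is the set of primes $p$ with $\tau(p)=\infty$, $R_\tau$ is the unital subring of $\mathbb{Q}$ whose additive group has type $\tau$, and a $P_0(\tau)$-number is a nonzero integer with no prime divisor in $P_\infty(\tau)$. For $G\in\mathcal{A}_0$ write $G=\langle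 d,A\rangle$. For $\tau\in T$, $m_\tau=m_\tau(G)$ is the order of $\pi_\tau(d)+A$ in $\tilde A/A$, where $\pi_\tau$ is the projection of $\tilde G=\bigoplus_{\sigma\in T}\tilde A_\sigma$ onto $\tilde A_\tau$ (it does not depend on $d$), and $T_0=\{\tau\in T\mid m_\tau>1\}$. A *main decomposition* is $G=G_1\oplus C$ with $C$ block-rigid completely decomposable and $G_1$ a rigid CRQ-group with $T(G_1)=T_0$ and $m_\tau(G_1)=m_\tau(G)$ for $\tau\in T_0$; fix one. An *rc-basis* of $G$, defined by an element $d\in G_1$ with $G=\langle d,A\rangle$, is a system $E_0=\{e_\tau\in \mathrm{Reg}_\tau G_1\mid\tau\in T_0\}$ with $\mathrm{Reg}\,G_1=\bigoplus_{\tau\in T_0}R_\tau e_\tau$ and $$d=\sum_{\tau\in T_0}\frac{s_\tau}{m_\tau}e_\tau ,$$ where $s_\tau,m_\tau$ are coprime integers and $P_0(\tau)$-numbers for every $\tau\in T_0$. If $G$ is rigid, an *r-basis* extending $E_0$ is a system $E=\{e_\tau\in A_\tau\mid \tau\in T\}$ containing $E_0$ with $A=\bigoplus_{\tau\in T}R_\tau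 e_\tau$. For a rigid $G\in\mathcal{A}_0$ let $$M_G(E_0)=\langle X\rangle+\prod_{\tau\in T}m_\tau^2A_\tau,\qquad X=(m_\tau s_\tau^{-1}e_\tau)_{\tau\in T_0},$$ where $s_\tau^{-1}$ is an integer inverse to $s_\tau$ modulo $m_\tau$ and the coordinates of $X$ outside $T_0$ are $0$. In the ring $R_G=\prod_{\tau\in T}R_\tau$ consider the subring $K_G=\mathbb{Z}1_{T_0}+\prod_{\tau\in T}m_\tau R_\tau$, where $1_{T_0}$ has coordinates $1$ on $T_0$ and $0$ elsewhere, and let $K_G^*$ be its group of units; $R_G$ acts on $\prod_{\tau\in T}\mathbb{Q}e_\tau$ coordinatewise. $\mathrm{Mult}\,G=\mathrm{Hom}(G\otimes G,G)$ is the group of multiplications on $G$; for $\times\in\mathrm{Mult}\,G$, $(G,\times)$ is the corresponding (not necessarily associative) ring. **Theorem 2.4 (The isomorphism theorem).** Let $G$ be a rigid group in $\mathcal{A}_0$ with an rc-basis $E_0$, and let $E=\{e_\tau\mid\tau\in T\}$ be an r-basis of $G$ extending $E_0$. Then $\times\mapsto U_\times=(e_\tau\times e_\tau)_{\tau\in T}$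 is an isomorphism of $\mathrm{Mult}\,G$ onto $M_G(E_0)$. If elements $U_*,U_\times\in M_G(E_0)$ determine in this way the rings $(G,*)$ and $(G,\times)$, respectively, then $(G,*)\cong(G,\times)$ if and only if there is an element $c\in K_G^*$ such that $U_*=cU_\times$. -/

import Mathlib

namespace ACDGroup

open scoped TensorProduct

/-! ### Heights, characteristics, types -/

/-- The `p`-height of `x` in the abelian group `G`, with value `⊤` if `x` is divisible by all powers
of `p`. -/
noncomputable def height {G : Type*} [AddCommGroup G] (x : G) (p : Nat.Primes) : ℕ∞ :=
  ⨆ k : {k : ℕ // ∃ y : G, ((p : ℕ) ^ k) • y = x}, ((k : ℕ) : ℕ∞)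

/-- Two characteristics are equivalent if they differ at finitely many primes only, and only at
primes where both of them are finite. -/
instance charSetoid : Setoid (Nat.Primes → ℕ∞) where
  r χ ψ := {p | χ p ≠ ψ p}.Finite ∧ ∀ p, χ p ≠ ψ p → χ p ≠ ⊤ ∧ ψ p ≠ ⊤
  iseqv :=
    { refl := fun χ => by simp
      symm := fun {χ ψ} h =>
        ⟨h.1.subset fun p hp => Ne.symm hp, fun p hp => (h.2 p (Ne.symm hp)).symm⟩
      trans := fun {χ ψ φ} h h' => by
        refine ⟨(h.1.union h'.1).subset fun p hp => ?_, fun p hp => ?_⟩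
        · simp only [Set.mem_union, Set.mem_ofPred_eq] at hp ⊢
          by_contra hc
          push Not at hc
          exact hp (hc.1.trans hc.2)
        · by_cases h1 : χ p = ψ p
          · by_cases h2 : ψ p = φ p
            · exact absurd (h1.trans h2) hp
            · exact ⟨h1 ▸ (h'.2 p h2).1, (h'.2 p h2).2⟩
          · by_cases h2 : ψ p = φ p
            · exact ⟨(h.2 p h1).1, h2 ▸ (h.2 p h1).2⟩
            · exact ⟨(h.2 p h1).1, (h'.2 p h2).2⟩ }

/-- Types (in the sense of torsion-free abelian groups): classes of equivalent characteristics. -/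
def GType : Type := Quotient charSetoid

/-- The type of an element of a group. -/
noncomputable def typeOf {G : Type*} [AddCommGroup G] (x : G) : GType :=
  Quotient.mk charSetoid (height x)

/-- The order of types: `τ ≤ σ` if some characteristic in `τ` is pointwise at most some
characteristic in `σ`. -/
def GType.le (τ σ : GType) : Prop :=
  ∃ χ ψ : Nat.Primes → ℕ∞, Quotient.mk charSetoid χ = τ ∧ Quotient.mk charSetoid ψ = σ ∧
    ∀ p, χ p ≤ ψ p

/-- A type is idempotent if it contains a characteristic with values `0` and `∞` only. -/
def GType.IsIdempotent (τ : GType) : Prop :=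
  ∃ χ : Nat.Primes → ℕ∞, Quotient.mk charSetoid χ = τ ∧ ∀ p, χ p = 0 ∨ χ p = ⊤

/-- `P_∞(τ) = {p | τ(p) = ∞}`. -/
def GType.PInf (τ : GType) : Set Nat.Primes :=
  Quotient.lift (fun χ : Nat.Primes → ℕ∞ => {p | χ p = ⊤}) (by
    intro χ ψ h
    ext p
    simp only [Set.mem_ofPred_eq]
    by_cases hp : χ p = ψ p
    · rw [hp]
    · exact ⟨fun h1 => absurd h1 (h.2 p hp).1, fun h1 => absurd h1 (h.2 p hp).2⟩) τ

/-- `P_0(τ)`, the complement of `P_∞(τ)`. -/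
def GType.PZero (τ : GType) : Set Nat.Primes := τ.PInfᶜ

/-- A `P`-number: a nonzero integer all of whose prime divisors are in `P`. -/
def IsPNumber (P : Set Nat.Primes) (n : ℤ) : Prop :=
  n ≠ 0 ∧ ∀ p : Nat.Primes, ((p : ℕ) : ℤ) ∣ n → p ∈ P

/-- `R_τ`: for an idempotent type `τ`, the unital subring of `ℚ` whose additive group has type `τ`,
that is, the fractions whose denominator has prime divisors in `P_∞(τ)` only. -/
def GType.R (τ : GType) : Subring ℚ where
  carrier := {q | ∀ p : Nat.Primes, (p : ℕ) ∣ q.den → p ∈ τ.PInf}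
  mul_mem' {a b} ha hb p hp :=
    ((Nat.Prime.dvd_mul p.2).1 (hp.trans (Rat.mul_den_dvd a b))).elim (ha p) (hb p)
  one_mem' p hp := absurd (Nat.dvd_one.1 hp) p.2.one_lt.ne'
  add_mem' {a b} ha hb p hp :=
    ((Nat.Prime.dvd_mul p.2).1 (hp.trans (Rat.add_den_dvd a b))).elim (ha p) (hb p)
  zero_mem' p hp := absurd (Nat.dvd_one.1 hp) p.2.one_lt.ne'
  neg_mem' {a} ha p hp := ha p (by simpa using hp)

/-! ### Completely decomposable and almost completely decomposable groups -/

/-- Torsion-free groups of rank one. -/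
def IsRankOne (X : Type*) [AddCommGroup X] : Prop :=
  IsAddTorsionFree X ∧ Module.rank ℤ X = 1

/-- The type of a torsion-free group of rank one is the common type of its nonzero elements. -/
def HasType (X : Type*) [AddCommGroup X] (τ : GType) : Prop :=
  ∀ x : X, x ≠ 0 → typeOf x = τ

/-- A decomposition of `A` into the direct sum of finitely many torsion-free subgroups of rank 1. -/
structure CompleteDecomposition (A : Type*) [AddCommGroup A] where
  k : ℕ
  summand : Fin k → AddSubgroup A
  isInternal : DirectSum.IsInternal summand
  rankOne : ∀ i, IsRankOne (summand i)

/-- The sum of the rank one summands of type `τ` in a complete decomposition. -/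
def CompleteDecomposition.part {A : Type*} [AddCommGroup A] (D : CompleteDecomposition A)
    (τ : GType) : AddSubgroup A :=
  ⨆ i : {i : Fin D.k // HasType (D.summand i) τ}, D.summand i

/-- Completely decomposable groups (of finite rank). -/
def IsCD (A : Type*) [AddCommGroup A] : Prop := Nonempty (CompleteDecomposition A)

/-- Almost completely decomposable groups: torsion-free groups of finite rank with a completely
decomposable subgroup of finite index. -/
structure IsACD (G : Type*) [AddCommGroup G] : Prop where
  torsionFree : IsAddTorsionFree G
  finiteRank : Module.rank ℤ G < Cardinal.aleph0
  exists_cd : ∃ H : AddSubgroup G, IsCD H ∧ H.FiniteIndex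

/-- A completely decomposable subgroup of (finite) least index. -/
def IsRegulating {G : Type*} [AddCommGroup G] (H : AddSubgroup G) : Prop :=
  IsCD H ∧ H.FiniteIndex ∧ ∀ H' : AddSubgroup G, IsCD H' → H'.FiniteIndex → H.index ≤ H'.index

/-- The regulator `Reg G`: the intersection of all completely decomposable subgroups of least
index. -/
def regulator (G : Type*) [AddCommGroup G] : AddSubgroup G :=
  sInf {H : AddSubgroup G | IsRegulating H}

open Classical in
/-- `Reg_τ G`: the sum of the rank one summands of type `τ` in a fixed complete decomposition of the
(completely decomposable) group `Reg G`. -/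
noncomputable def regPart (G : Type*) [AddCommGroup G] (τ : GType) : AddSubgroup G :=
  if h : IsCD (regulator G) then ((Classical.choice h).part τ).map (regulator G).subtype else ⊥

/-- The set `T(G)` of critical types. -/
def critTypes (G : Type*) [AddCommGroup G] : Set GType := {τ | regPart G τ ≠ ⊥}

/-- Helper: there are only finitely many critical types, so that sums over them make sense. -/
theorem critTypes_finite (G : Type*) [AddCommGroup G] : (critTypes G).Finite := by
  classical
  by_cases h : IsCD (regulator G)
  · refine Set.Finite.subset (Set.finite_range fun i : Fin (Classical.choice h).k =>
      if hx : ∃ x : (Classical.choice h).summand i, x ≠ 0 then typeOf hx.choose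
      else typeOf (0 : G)) ?_
    intro τ hτ
    simp only [critTypes, regPart, dif_pos h, Set.mem_ofPred_eq] at hτ
    by_cases hi : Nonempty {i : Fin (Classical.choice h).k //
        HasType ((Classical.choice h).summand i) τ}
    · obtain ⟨i, hi⟩ := hi
      refine ⟨i, ?_⟩
      have hx : ∃ x : (Classical.choice h).summand i, x ≠ 0 := by
        have hr := ((Classical.choice h).rankOne i).2
        by_contra hc
        push Not at hc
        have : Subsingleton ((Classical.choice h).summand i) :=
          ⟨fun a b => (hc a).trans (hc b).symm⟩
        rw [rank_subsingleton'] at hr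
        exact zero_ne_one hr
      simp only [dif_pos hx]
      exact hi _ hx.choose_spec
    · exfalso
      apply hτ
      have := not_nonempty_iff.1 hi
      rw [CompleteDecomposition.part, iSup_of_empty, AddSubgroup.map_bot]
  · convert Set.finite_empty
    ext τ
    simp [critTypes, regPart, h]

/-- Block-rigid groups: the critical types are pairwise incomparable. -/
def IsBlockRigid (G : Type*) [AddCommGroup G] : Prop :=
  ∀ τ ∈ critTypes G, ∀ σ ∈ critTypes G, τ ≠ σ → ¬ τ.le σ

/-- Rigid groups: block-rigid, and every `Reg_τ G` with `τ` critical has rank 1. -/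
def IsRigid (G : Type*) [AddCommGroup G] : Prop :=
  IsBlockRigid G ∧ ∀ τ ∈ critTypes G, Module.rank ℤ (regPart G τ) = 1

/-- Groups of ring type: all critical types are idempotent. -/
def IsRingType (G : Type*) [AddCommGroup G] : Prop :=
  ∀ τ ∈ critTypes G, τ.IsIdempotent

/-- CRQ-groups: almost completely decomposable groups with cyclic regulator quotient. -/
def IsCRQ (G : Type*) [AddCommGroup G] : Prop :=
  IsACD G ∧ IsAddCyclic (G ⧸ regulator G)

/-- The class `𝒜₀` of block-rigid almost completely decomposable groups of ring type with cyclic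
regulator quotient. -/
structure InA0 (G : Type*) [AddCommGroup G] : Prop where
  crq : IsCRQ G
  blockRigid : IsBlockRigid G
  ringType : IsRingType G

/-! ### The divisible hull and the invariants `m_τ` -/

/-- The divisible hull of a torsion-free group. -/
abbrev Hull (G : Type*) [AddCommGroup G] : Type _ := ℚ ⊗[ℤ] G

/-- The canonical embedding of (torsion-free) `G` into its divisible hull. -/
noncomputable def toHull (G : Type*) [AddCommGroup G] : G →+ Hull G :=
  (TensorProduct.mk ℤ ℚ G 1).toAddMonoidHom

/-- The divisible hull of `Reg_τ G` inside the one of `G`. -/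
noncomputable def hullPart (G : Type*) [AddCommGroup G] (τ : GType) : Submodule ℚ (Hull G) :=
  Submodule.span ℚ (toHull G '' (regPart G τ : Set G))

open Classical in
/-- The projection of the divisible hull of `G` onto the divisible hull of `Reg_τ G`, along the sum
of the hulls for the other critical types. -/
noncomputable def proj (G : Type*) [AddCommGroup G] (τ : GType) : Hull G →ₗ[ℚ] Hull G :=
  if h : IsCompl (hullPart G τ) (⨆ σ ∈ critTypes G \ {τ}, hullPart G σ) then
    Submodule.projection _ _ h else 0

/-- `d` represents a generator of the regulator quotient: `G = ⟨d, Reg G⟩`. -/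
def IsRegGenerator {G : Type*} [AddCommGroup G] (d : G) : Prop :=
  AddSubgroup.zmultiples d ⊔ regulator G = ⊤

open Classical in
/-- The invariant `m_τ(G)`: the order of `π_τ(d) + A` in `Ã / A`, where `A = Reg G` and
`G = ⟨d, A⟩`; it does not depend on the choice of `d`. -/
noncomputable def mInv (G : Type*) [AddCommGroup G] (τ : GType) : ℕ :=
  if h : ∃ d : G, IsRegGenerator d then
    addOrderOf (QuotientAddGroup.mk (proj G τ (toHull G h.choose)) :
      Hull G ⧸ (regulator G).map (toHull G))
  else 0

/-- `T_0(G)`, the set of critical types with `m_τ > 1`. -/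
def critTypes₀ (G : Type*) [AddCommGroup G] : Set GType := {τ | τ ∈ critTypes G ∧ 1 < mInv G τ}

/-- A main decomposition `G = G₁ ⊕ C`. -/
structure IsMainDecomposition {G : Type*} [AddCommGroup G] (G₁ C : AddSubgroup G) : Prop where
  isCompl : IsCompl G₁ C
  cd : IsCD C
  blockRigid : IsBlockRigid C
  crq : IsCRQ G₁
  rigid : IsRigid G₁
  critTypes_eq : critTypes G₁ = critTypes₀ G
  mInv_eq : ∀ τ ∈ critTypes G₁, mInv G₁ τ = mInv G τ

/-! ### Bases -/

/-- The cyclic `R_τ`-submodule `R_τ e` of the divisible hull of `G`. -/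
noncomputable def cyc {G : Type*} [AddCommGroup G] (τ : GType) (e : G) : AddSubgroup (Hull G) :=
  τ.R.toAddSubgroup.map (LinearMap.toSpanSingleton ℚ (Hull G) (toHull G e)).toAddMonoidHom

/-- `e₀` is an rc-basis of `G`, relative to the main decomposition with first summand `G₁`, defined
by the element `d`, and `s` is the family of numerators in the standard representation
`d = ∑ (s_τ / m_τ) e₀^(τ)`. -/
structure IsRCBasis {G : Type*} [AddCommGroup G] (G₁ : AddSubgroup G) (d : G)
    (e₀ : critTypes₀ G → G) (s : critTypes₀ G → ℤ) : Prop where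
  mem_G₁ : d ∈ G₁
  generator : IsRegGenerator d
  mem_part : ∀ τ : critTypes₀ G, e₀ τ ∈ (regPart G₁ (τ : GType)).map G₁.subtype
  independent : iSupIndep fun τ : critTypes₀ G => cyc (τ : GType) (e₀ τ)
  sum_eq : ⨆ τ : critTypes₀ G, cyc (τ : GType) (e₀ τ) =
    ((regulator G₁).map G₁.subtype).map (toHull G)
  standard_rep : toHull G d =
    ∑ᶠ τ : critTypes₀ G, ((s τ : ℚ) / (mInv G τ : ℚ)) • toHull G (e₀ τ)
  coprime : ∀ τ : critTypes₀ G, IsCoprime (s τ) (mInv G τ : ℤ)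
  s_number : ∀ τ : critTypes₀ G, IsPNumber (τ : GType).PZero (s τ)
  m_number : ∀ τ : critTypes₀ G, IsPNumber (τ : GType).PZero (mInv G τ : ℤ)

/-- `e` is an r-basis of the rigid group `G` which extends the rc-basis `e₀`. -/
structure IsRBasis {G : Type*} [AddCommGroup G] (e : critTypes G → G) (e₀ : critTypes₀ G → G) :
    Prop where
  mem_part : ∀ τ : critTypes G, e τ ∈ regPart G (τ : GType)
  independent : iSupIndep fun τ : critTypes G => cyc (τ : GType) (e τ)
  sum_eq : ⨆ τ : critTypes G, cyc (τ : GType) (e τ) = (regulator G).map (toHull G)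
  extends_rc : ∀ τ : critTypes₀ G, e ⟨τ, τ.2.1⟩ = e₀ τ

/-! ### The group `M_G(E₀)` of a rigid group -/

open Classical in
/-- The element `X = (m_τ s_τ⁻¹ e_τ)`, over `τ ∈ T_0`, with `s_τ⁻¹` an integer that is inverse to
`s_τ` modulo `m_τ`; the coordinates outside of `T_0` are `0`. -/
noncomputable def elemX {G : Type*} [AddCommGroup G] (e₀ : critTypes₀ G → G)
    (s : critTypes₀ G → ℤ) : critTypes G → G := fun τ =>
  if h : (τ : GType) ∈ critTypes₀ G then
    (mInv G τ * ((s ⟨τ, h⟩ : ZMod (mInv G τ))⁻¹).val) • e₀ ⟨τ, h⟩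
  else 0

/-- `M^(2) = ∏ m_τ² A_τ`, over all `τ ∈ T(G)`, where `A_τ = Reg_τ G`. -/
noncomputable def subgroupM2 (G : Type*) [AddCommGroup G] : AddSubgroup (critTypes G → G) :=
  AddSubgroup.pi Set.univ fun τ => (regPart G τ).map (nsmulAddMonoidHom (mInv G τ ^ 2))

/-- `M_G(E₀) = ⟨X, M^(2)⟩`. -/
noncomputable def groupM {G : Type*} [AddCommGroup G] (e₀ : critTypes₀ G → G)
    (s : critTypes₀ G → ℤ) : AddSubgroup (critTypes G → G) :=
  AddSubgroup.zmultiples (elemX e₀ s) ⊔ subgroupM2 G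

/-! ### The ring `K_G` -/

/-- The ring `R_G = ∏ R_τ`, over all `τ ∈ T(G)`. -/
abbrev RingR (G : Type*) [AddCommGroup G] : Type := ∀ τ : critTypes G, (τ : GType).R

open Classical in
/-- The element `1_{T_0}` of `R_G`. -/
noncomputable def oneT₀ (G : Type*) [AddCommGroup G] : RingR G := fun τ =>
  if (τ : GType) ∈ critTypes₀ G then 1 else 0

/-- `K_G = ℤ 1_{T_0} + ∏ m_τ R_τ`. (As `m_τ = 1` for `τ ∉ T_0`, it contains the identity of
`R_G`.) -/
noncomputable def ringK (G : Type*) [AddCommGroup G] : AddSubgroup (RingR G) :=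
  AddSubgroup.zmultiples (oneT₀ G) ⊔
    AddSubgroup.pi Set.univ fun τ : critTypes G =>
      (nsmulAddMonoidHom (α := (τ : GType).R) (mInv G τ)).range

/-- The multiplicative group `K_G^*`: the elements of `K_G` with an inverse in `K_G`. -/
def unitsK (G : Type*) [AddCommGroup G] : Set (RingR G) :=
  {c | c ∈ ringK G ∧ ∃ c' ∈ ringK G, c * c' = 1}

/-! ### Multiplications -/

/-- The group `Mult G` of multiplications on `G`. -/
abbrev Mult (G : Type*) [AddCommGroup G] : Type _ := G ⊗[ℤ] G →ₗ[ℤ] G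

/-- The (not necessarily associative) rings `(G, μ)` and `(G, ν)` are isomorphic. -/
def RingsIsomorphic {G : Type*} [AddCommGroup G] (μ ν : Mult G) : Prop :=
  ∃ f : G ≃+ G, ∀ x y : G, f (μ (x ⊗ₜ[ℤ] y)) = ν (f x ⊗ₜ[ℤ] f y)

/-- The homomorphism which takes a multiplication `×` on `G` to the element
`U = (e_τ × e_τ)`, `τ ∈ T(G)`. -/
def multVector {G : Type*} [AddCommGroup G] (e : critTypes G → G) :
    Mult G →+ (critTypes G → G) where
  toFun μ := fun τ => μ (e τ ⊗ₜ[ℤ] e τ)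
  map_zero' := rfl
  map_add' _ _ := rfl

end ACDGroup

open ACDGroup

namespace ACDGroup

open scoped TensorProduct

/-! ### Idempotent types and their rings -/

/-! Everything is read in the coordinates given by the r-basis: `φ` embeds G in ℚ^T, the regulator A
consists of the elements with every coordinate in R_τ, and G = ℤd + A, where d has coordinates
s_τ/m_τ.

Multiplications and endomorphisms are diagonal. The element e_τ is divisible by all powers of the
primes in P_∞(τ), and so is every homomorphic image of it; a nonzero σ-coordinate of the image
forces P_∞(τ) ⊆ P_∞(σ), hence τ = σ because the types are idempotent and pairwise incomparable
(`IsCoordinates.map_apply`, `mult_apply`). So e_τ × e_τ = u_τ e_τ, and the rationals u_τ determine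
the multiplication.

The arithmetic comes from d. Elements on a coordinate axis lie in A (`mem_regulator_of_supported`):
every regulating subgroup lies in the sum of the axes, which is itself completely decomposable, so
the two agree by minimality of the index. Hence d × e_τ ∈ A, which gives m_τ ∣ u_τ in R_τ, and d × d
∈ kd + A, which gives u_τ ≡ k m_τ s_τ⁻¹ modulo m_τ² with one k for all τ. This is membership in
M_G(E₀), and it is also sufficient (`mult_basis_eq`, `exists_mult`). In the same way a diagonal map
c preserves G exactly when c_τ ≡ k modulo m_τ with a common k, that is, when c ∈ K_G. An isomorphism
c of rings satisfies c u_* = c² u_×, and one factor c cancels (`ringsIsomorphic_iff`). -/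

theorem GType.le_of_pInf_subset {τ σ : GType} (hτ : τ.IsIdempotent) (hσ : σ.IsIdempotent)
    (h : τ.PInf ⊆ σ.PInf) : τ.le σ := by
  obtain ⟨χ, rfl, hχ⟩ := hτ
  obtain ⟨ψ, rfl, hψ⟩ := hσ
  refine ⟨χ, ψ, rfl, rfl, fun p => ?_⟩
  rcases hχ p with h0 | h1
  · simp [h0]
  · have : ψ p = ⊤ := h (show χ p = ⊤ from h1)
    simp [this]

/-- The only form in which block-rigidity enters the proof. -/
theorem eq_of_pInf_subset {G : Type*} [AddCommGroup G] (hb : IsBlockRigid G) (hr : IsRingType G)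
    {τ σ : critTypes G} (h : (τ : GType).PInf ⊆ (σ : GType).PInf) : τ = σ := by
  by_contra hne
  exact hb τ τ.2 σ σ.2 (fun h' => hne (Subtype.ext h'))
    (GType.le_of_pInf_subset (hr τ τ.2) (hr σ σ.2) h)

theorem GType.inv_prime_pow_mem_R {τ : GType} {p : Nat.Primes} (hp : p ∈ τ.PInf) (k : ℕ) :
    (((p : ℕ) : ℚ) ^ k)⁻¹ ∈ τ.R := by
  rw [← inv_pow]
  refine pow_mem ?_ k
  intro q hq
  rw [Rat.inv_natCast_den_of_pos p.2.pos] at hq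
  rwa [show q = p from Subtype.ext ((Nat.prime_dvd_prime_iff_eq q.2 p.2).1 hq)]

/-- If p is outside P_∞(τ), elements of R_τ have nonnegative p-adic valuation, which bounds the
powers of p that can be split off from q. -/
theorem GType.mem_pInf_of_forall_div_mem_R {τ : GType} {p : Nat.Primes} {q : ℚ} (hq : q ≠ 0)
    (h : ∀ k : ℕ, ∃ r ∈ τ.R, ((p : ℕ) : ℚ) ^ k * r = q) : p ∈ τ.PInf := by
  by_contra hp
  have : Fact (p : ℕ).Prime := ⟨p.2⟩
  obtain ⟨r, hr, hrq⟩ := h ((padicValRat p q).toNat + 1)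
  have hden : ¬ (p : ℕ) ∣ r.den := fun hd => hp (hr p hd)
  have hr0 : r ≠ 0 := by rintro rfl; exact hq (by rw [← hrq, mul_zero])
  have hp0 : ((p : ℕ) : ℚ) ≠ 0 := by exact_mod_cast p.2.ne_zero
  have hv : 0 ≤ padicValRat p r := by
    rw [padicValRat, padicValNat.eq_zero_of_not_dvd hden]
    simp
  have := congrArg (padicValRat p) hrq
  rw [padicValRat.mul (pow_ne_zero _ hp0) hr0, padicValRat.pow, padicValRat.self p.2.one_lt]
    at this
  push_cast at this
  have := Int.self_le_toNat (padicValRat p q)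
  lia

/-- Cancelling a numerator which is coprime to the denominator. -/
theorem mem_of_coprime_mul_div_mem {R : Subring ℚ} {s m : ℤ} (hsm : IsCoprime s m) (hm : m ≠ 0)
    {x : ℚ} (hx : x ∈ R) (h : x * (s / m) ∈ R) : x / m ∈ R := by
  obtain ⟨a, b, hab⟩ := hsm
  have hm' : (m : ℚ) ≠ 0 := by exact_mod_cast hm
  have hab' : (a : ℚ) * s + b * m = 1 := by exact_mod_cast hab
  have : x / m = a * (x * (s / m)) + b * x := by
    field_simp
    linear_combination (-x) * hab'
  rw [this]
  exact add_mem (mul_mem (intCast_mem _ a) h) (mul_mem (intCast_mem _ b) hx)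

/-! ### Coordinates with respect to a basis of a subgroup of bounded index -/

theorem toHull_injective {G : Type*} [AddCommGroup G] [IsAddTorsionFree G] :
    Function.Injective (toHull G) := by
  rw [injective_iff_map_eq_zero]
  intro g hg
  have h : TensorProduct.mk ℤ ℚ G 1 g = 0 := hg
  rw [IsLocalizedModule.eq_zero_iff (nonZeroDivisors ℤ)] at h
  obtain ⟨c, hc⟩ := h
  exact (smul_eq_zero.1 (show (c : ℤ) • g = 0 from hc)).resolve_left (nonZeroDivisors.coe_ne_zero c)

theorem smul_toHull {G : Type*} [AddCommGroup G] (q : ℚ) (g : G) :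
    q ⊗ₜ[ℤ] g = q • toHull G g := by
  simp [toHull, TensorProduct.smul_tmul']

theorem mem_cyc {G : Type*} [AddCommGroup G] {τ : GType} {e : G} {x : Hull G} :
    x ∈ cyc τ e ↔ ∃ r ∈ τ.R, r • toHull G e = x := by
  rfl

/-- `φ` is the family of coordinates with respect to the family `e`, which is an `R`-basis of the
subgroup `A` of bounded index. -/
structure IsCoordinates {G : Type*} [AddCommGroup G] {T : Type*} [Finite T] [DecidableEq T]
    (t : T → GType) (e : T → G) (A : AddSubgroup G) (φ : G →+ (T → ℚ)) : Prop where
  injective : Function.Injective φ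
  map_basis : ∀ i, φ (e i) = Pi.single i 1
  mem_iff : ∀ g, g ∈ A ↔ ∀ i, φ g i ∈ (t i).R
  exists_of_mem : ∀ v : T → ℚ, (∀ i, v i ∈ (t i).R) → ∃ g, φ g = v
  toHull_eq : ∀ g, toHull G g = ∑ᶠ i, φ g i • toHull G (e i)
  exists_linearMap : ∃ Φ : Hull G →ₗ[ℚ] (T → ℚ), ∀ g, φ g = Φ (toHull G g)
  bounded : ∃ N : ℕ, N ≠ 0 ∧ ∀ g : G, N • g ∈ A

/-- Independence of the subgroups makes the basis linearly independent over ℤ, hence over ℚ; bounded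
index of A makes it span the hull. The coordinates are those of the resulting ℚ-basis. -/
theorem exists_isCoordinates {G : Type*} [AddCommGroup G] [IsAddTorsionFree G]
    {T : Type*} [Finite T] [DecidableEq T]
    (t : T → GType) (e : T → G) (A : AddSubgroup G) (he : ∀ i, e i ≠ 0)
    (hind : iSupIndep fun i => cyc (t i) (e i))
    (hsup : ⨆ i, cyc (t i) (e i) = A.map (toHull G))
    (hN : ∃ N : ℕ, N ≠ 0 ∧ ∀ g : G, N • g ∈ A) :
    ∃ φ : G →+ (T → ℚ), IsCoordinates t e A φ := by
  have := Fintype.ofFinite T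
  have hcyc : ∀ i, toHull G (e i) ∈ cyc (t i) (e i) := fun i =>
    mem_cyc.2 ⟨1, one_mem _, one_smul _ _⟩
  have hlin : LinearIndependent ℚ fun i => toHull G (e i) := by
    rw [← LinearIndependent.iff_fractionRing ℤ ℚ]
    have : Module.IsTorsionFree ℤ (Hull G) := Module.IsTorsionFree.trans_faithfulSMul ℤ ℚ _
    exact (hind.map_orderIso AddSubgroup.toIntSubmodule).linearIndependent _ hcyc
      fun i h => he i (toHull_injective (h.trans (map_zero _).symm))
  have hle : ∀ x ∈ A.map (toHull G), x ∈ Submodule.span ℚ (Set.range fun i => toHull G (e i)) := by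
    rw [← hsup]
    intro x hx
    induction hx using AddSubgroup.iSup_induction' with
    | hp i x hx =>
      obtain ⟨r, -, rfl⟩ := mem_cyc.1 hx
      exact Submodule.smul_mem _ _ (Submodule.subset_span ⟨i, rfl⟩)
    | h1 => exact zero_mem _
    | hadd x y _ _ hx hy => exact add_mem hx hy
  have hspan : ⊤ ≤ Submodule.span ℚ (Set.range fun i => toHull G (e i)) := by
    rintro x -
    induction x using TensorProduct.induction_on with
    | zero => exact zero_mem _
    | add x y hx hy => exact add_mem hx hy
    | tmul q g =>
      rw [smul_toHull]
      refine Submodule.smul_mem _ _ ?_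
      obtain ⟨N, hN0, hN⟩ := hN
      have h := hle _ ⟨N • g, hN g, rfl⟩
      rw [map_nsmul, ← Nat.cast_smul_eq_nsmul ℚ] at h
      exact (Submodule.smul_mem_iff _ (by exact_mod_cast hN0)).1 h
  let b := Module.Basis.mk hlin hspan
  have hb : ∀ i, b i = toHull G (e i) := fun i => by simp [b]
  let φ : G →+ (T → ℚ) := b.equivFun.toLinearMap.toAddMonoidHom.comp (toHull G)
  have hφ : ∀ g, φ g = b.equivFun (toHull G g) := fun g => rfl
  have hex : ∀ v : T → ℚ, (∀ i, v i ∈ (t i).R) → ∃ g ∈ A, φ g = v := by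
    intro v hv
    have : b.equivFun.symm v ∈ A.map (toHull G) := by
      rw [← hsup, Module.Basis.equivFun_symm_apply]
      refine sum_mem fun i _ => AddSubgroup.mem_iSup_of_mem i ?_
      rw [hb]
      exact mem_cyc.2 ⟨_, hv i, rfl⟩
    obtain ⟨g, hg, hgv⟩ := this
    exact ⟨g, hg, by rw [hφ, hgv, LinearEquiv.apply_symm_apply]⟩
  have hinj : Function.Injective φ := b.equivFun.injective.comp toHull_injective
  refine ⟨φ, hinj, fun i => ?_, fun g => ⟨fun hg => ?_, fun hg => ?_⟩, fun v hv => ?_,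
    fun g => ?_, ⟨b.equivFun.toLinearMap, hφ⟩, hN⟩
  · ext j
    rw [hφ, ← hb, Module.Basis.equivFun_self, Pi.single_apply]
    simp [eq_comm]
  · have hx : toHull G g ∈ A.map (toHull G) := ⟨g, hg, rfl⟩
    rw [hφ]
    generalize toHull G g = x at hx
    rw [← hsup] at hx
    induction hx using AddSubgroup.iSup_induction' with
    | hp i x hx =>
      obtain ⟨r, hr, rfl⟩ := mem_cyc.1 hx
      intro j
      rw [← hb, map_smul, Pi.smul_apply, Module.Basis.equivFun_self]
      split_ifs with h
      · subst h; simpa using hr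
      · simp
    | h1 => intro j; simp
    | hadd x y _ _ hx hy => intro j; simpa using add_mem (hx j) (hy j)
  · obtain ⟨a, ha, hag⟩ := hex _ hg
    rwa [← hinj hag]
  · obtain ⟨g, -, hg⟩ := hex v hv
    exact ⟨g, hg⟩
  · rw [finsum_eq_sum_of_fintype, hφ]
    simp_rw [← hb]
    rw [Module.Basis.sum_equivFun]

/-- Divisibility by all powers of all primes in `P`. -/
def IsDivisibleBy {G : Type*} [AddCommGroup G] (P : Set Nat.Primes) (g : G) : Prop :=
  ∀ p ∈ P, ∀ k : ℕ, ∃ y : G, ((p : ℕ) ^ k) • y = g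

theorem IsDivisibleBy.map {G H : Type*} [AddCommGroup G] [AddCommGroup H] {P : Set Nat.Primes}
    {g : G} (h : IsDivisibleBy P g) (f : G →+ H) : IsDivisibleBy P (f g) := fun p hp k => by
  obtain ⟨y, rfl⟩ := h p hp k
  exact ⟨f y, (map_nsmul f _ _).symm⟩

/-! ### Infinite divisibility and diagonal endomorphisms -/

namespace IsCoordinates

variable {G : Type*} [AddCommGroup G] {T : Type*} [Finite T] [DecidableEq T]
  {t : T → GType} {e : T → G} {A : AddSubgroup G} {φ : G →+ (T → ℚ)}

theorem pInf_subset (h : IsCoordinates t e A φ) {P : Set Nat.Primes} {g : G}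
    (hg : IsDivisibleBy P g) {i : T} (hi : φ g i ≠ 0) : P ⊆ (t i).PInf := by
  intro p hp
  obtain ⟨N, hN0, hN⟩ := h.bounded
  -- The factor N moves g and its quotients by powers of p into A, where coordinates are known to
  -- lie in the rings.
  refine GType.mem_pInf_of_forall_div_mem_R (q := N * φ g i)
    (mul_ne_zero (by exact_mod_cast hN0) hi) fun k => ?_
  obtain ⟨y, rfl⟩ := hg p hp k
  refine ⟨N * φ y i, ?_, ?_⟩
  · have := (h.mem_iff _).1 (hN y) i
    simpa using this
  · simp
    ring

theorem basis_isDivisibleBy (h : IsCoordinates t e A φ) (i : T) :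
    IsDivisibleBy (t i).PInf (e i) := by
  intro p hp k
  obtain ⟨y, hy⟩ := h.exists_of_mem (Pi.single i (((p : ℕ) : ℚ) ^ k)⁻¹) fun j => by
    rcases eq_or_ne j i with rfl | hj
    · simp [GType.inv_prime_pow_mem_R hp k]
    · simp [hj]
  refine ⟨y, h.injective ?_⟩
  have hp0 : ((p : ℕ) : ℚ) ≠ 0 := by exact_mod_cast p.2.ne_zero
  rw [map_nsmul, hy, h.map_basis, ← Pi.single_smul]
  simp [hp0]

/-- Every element has a nonzero multiple in the subgroup generated by the basis. -/
theorem exists_zsmul_eq_sum [Fintype T] (h : IsCoordinates t e A φ) (g : G) :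
    ∃ n : ℤ, n ≠ 0 ∧ ∃ k : T → ℤ, n • g = ∑ i, k i • e i := by
  obtain ⟨n, hn⟩ := IsLocalization.exist_integer_multiples_of_finite (nonZeroDivisors ℤ) (φ g)
  choose k hk using hn
  refine ⟨n, nonZeroDivisors.coe_ne_zero n, k, h.injective ?_⟩
  ext j
  have := hk j
  simp only [map_zsmul, map_sum, h.map_basis, Finset.sum_apply, Pi.smul_apply, Pi.single_apply]
  simp at this ⊢
  exact this.symm

/-- In coordinates, every endomorphism is a diagonal map if the types are incomparable. -/
theorem map_apply (h : IsCoordinates t e A φ)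
    (ht : ∀ i j, (t i).PInf ⊆ (t j).PInf → i = j) (f : G →+ G) (g : G) (i : T) :
    φ (f g) i = φ (f (e i)) i * φ g i := by
  have := Fintype.ofFinite T
  obtain ⟨n, hn, k, hk⟩ := h.exists_zsmul_eq_sum g
  have hn' : (n : ℚ) ≠ 0 := by exact_mod_cast hn
  have h1 := congrFun (congrArg φ hk) i
  have h2 := congrFun (congrArg (fun x => φ (f x)) hk) i
  simp only [map_zsmul, map_sum, h.map_basis, Finset.sum_apply, Pi.smul_apply] at h1 h2
  rw [Finset.sum_eq_single i (fun j _ hj => by simp [hj.symm]) (by simp)] at h1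
  -- The image of e_j inherits the divisibility of e_j, so a nonzero i-th coordinate would force j =
  -- i.
  rw [Finset.sum_eq_single i (fun j _ hj => by
    by_contra hc
    exact hj (ht _ _ (h.pInf_subset ((h.basis_isDivisibleBy j).map f)
      (fun h0 => hc (by rw [h0, smul_zero]))))) (by simp)] at h2
  simp at h1 h2
  apply mul_left_cancel₀ hn'
  linear_combination h2 - φ (f (e i)) i * h1

end IsCoordinates

/-! ### Groups of rank one and complete decompositions -/

theorem IsRankOne.exists_ne_zero {X : Type*} [AddCommGroup X] (h : IsRankOne X) :
    ∃ x : X, x ≠ 0 := by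
  by_contra! hc
  have : Subsingleton X := ⟨fun a b => (hc a).trans (hc b).symm⟩
  have hr := h.2
  rw [rank_subsingleton'] at hr
  exact zero_ne_one hr

theorem IsRankOne.exists_zsmul_eq {X : Type*} [AddCommGroup X] (h : IsRankOne X) {x : X}
    (hx : x ≠ 0) (y : X) : ∃ n k : ℤ, n ≠ 0 ∧ n • y = k • x := by
  have := h.1
  by_contra! hc
  have hlin : LinearIndependent ℤ ![x, y] := by
    rw [LinearIndependent.pair_iff]
    intro a b hab
    have hb : b = 0 := by
      by_contra hb
      exact hc b (-a) hb (by rw [neg_smul]; exact eq_neg_of_add_eq_zero_right hab)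
    subst hb
    simpa [hx] using hab
  have := hlin.cardinal_lift_le_rank
  rw [h.2] at this
  norm_num at this

theorem isRankOne_of_injective {X : Type*} [AddCommGroup X] (f : X →+ ℚ)
    (hf : Function.Injective f) {x : X} (hx : x ≠ 0) : IsRankOne X := by
  have htf : IsAddTorsionFree X := hf.isAddTorsionFree f
  refine ⟨htf, le_antisymm ?_ ?_⟩
  · have h := LinearMap.lift_rank_le_of_injective f.toIntLinearMap hf
    have hQ : Module.rank ℤ ℚ = 1 := by
      rw [← IsLocalization.rank_eq ℚ (nonZeroDivisors ℤ) le_rfl, Module.rank_self]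
    rw [hQ] at h
    simpa using h
  · rw [Cardinal.one_le_iff_ne_zero]
    intro h0
    exact hx (rank_zero_iff.1 h0 |>.elim x 0)

/-- The projections of a complete decomposition. -/
theorem CompleteDecomposition.exists_projections {A : Type*} [AddCommGroup A]
    (D : CompleteDecomposition A) : ∃ π : Fin D.k → A →+ A, (∀ i a, π i a ∈ D.summand i) ∧
      (∀ i, ∀ a ∈ D.summand i, π i a = a) ∧ (∀ i j, i ≠ j → ∀ a ∈ D.summand i, π j a = 0) ∧
      ∀ a, a = ∑ i, π i a := by
  classical
  let E := AddEquiv.ofBijective _ D.isInternal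
  let π : Fin D.k → A →+ A := fun i => (D.summand i).subtype.comp
    ((DFinsupp.evalAddMonoidHom i).comp E.symm.toAddMonoidHom)
  have hπ : ∀ i a, π i a = (E.symm a i : A) := fun _ _ => rfl
  have hof : ∀ i a (ha : a ∈ D.summand i),
      E.symm a = DirectSum.of (fun i => D.summand i) i ⟨a, ha⟩ := by
    intro i a ha
    rw [AddEquiv.symm_apply_eq]
    exact (DirectSum.coeAddMonoidHom_of D.summand i ⟨a, ha⟩).symm
  refine ⟨π, fun i a => (E.symm a i).2, fun i a ha => ?_, fun i j hij a ha => ?_, fun a => ?_⟩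
  · rw [hπ, hof i a ha, DirectSum.of_eq_same]
  · rw [hπ, hof i a ha, DirectSum.of_eq_of_ne _ _ _ hij.symm]
    rfl
  · obtain ⟨x, rfl⟩ := E.surjective a
    simp only [hπ, AddEquiv.symm_apply_apply]
    change DirectSum.coeAddMonoidHom D.summand x = _
    rw [DirectSum.coeAddMonoidHom_eq_dfinsuppSum]
    exact DFinsupp.sum_eq_sum_fintype _ (by simp)

/-- If x is not divisible by p^k, its p-height is at most k, hence not infinite. -/
theorem HasType.isDivisibleBy {X : Type*} [AddCommGroup X] {τ : GType} (h : HasType X τ) (x : X) :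
    IsDivisibleBy τ.PInf x := by
  rcases eq_or_ne x 0 with rfl | hx
  · exact fun p _ k => ⟨0, smul_zero _⟩
  intro p hp k
  by_contra hk
  rw [← h x hx] at hp
  have htop : height x p = ⊤ := hp
  have : height x p ≤ k := by
    refine iSup_le ?_
    rintro ⟨l, y, rfl⟩
    by_contra! hl
    have hl : k ≤ l := by exact_mod_cast hl.le
    exact hk ⟨(p : ℕ) ^ (l - k) • y, by rw [smul_smul, ← pow_add, Nat.add_sub_cancel' hl]⟩
  rw [htop] at this
  exact absurd this (by simp)

/-! ### The regulator -/

theorem IsACD.exists_isRegulating {G : Type*} [AddCommGroup G] (h : IsACD G) :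
    ∃ H : AddSubgroup G, IsRegulating H := by
  classical
  have hex : ∃ n, ∃ H : AddSubgroup G, IsCD H ∧ H.FiniteIndex ∧ H.index = n := by
    obtain ⟨H, h1, h2⟩ := h.exists_cd
    exact ⟨_, H, h1, h2, rfl⟩
  obtain ⟨H, h1, h2, h3⟩ := Nat.find_spec hex
  exact ⟨H, h1, h2, fun H' h1' h2' => h3 ▸ Nat.find_min' hex ⟨H', h1', h2', rfl⟩⟩

/-- All regulating subgroups have the same index, and this single number multiplies G into each of
them, hence into their intersection. -/
theorem IsACD.exists_nsmul_mem_regulator {G : Type*} [AddCommGroup G] (h : IsACD G) :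
    ∃ N : ℕ, N ≠ 0 ∧ ∀ g : G, N • g ∈ regulator G := by
  obtain ⟨H, hH⟩ := h.exists_isRegulating
  refine ⟨H.index, hH.2.1.index_ne_zero, fun g => ?_⟩
  rw [regulator, AddSubgroup.mem_sInf]
  intro K hK
  rw [le_antisymm (hH.2.2 K hK.1 hK.2.1) (hK.2.2 H hH.1 hH.2.1)]
  exact K.nsmul_index_mem g

/-- The sum of the pure hulls of the elements of the basis. -/
def pureSum {G T : Type*} [AddCommGroup G] [DecidableEq T] (φ : G →+ (T → ℚ)) : AddSubgroup G where
  carrier := {g | ∀ i, ∃ x, φ x = Pi.single i (φ g i)}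
  zero_mem' i := ⟨0, by simp⟩
  add_mem' {a b} ha hb i := by
    obtain ⟨x, hx⟩ := ha i
    obtain ⟨y, hy⟩ := hb i
    exact ⟨x + y, by simp [hx, hy, Pi.single_add]⟩
  neg_mem' {a} ha i := by
    obtain ⟨x, hx⟩ := ha i
    exact ⟨-x, by simp [hx, Pi.single_neg]⟩

theorem mem_pureSum_of_supported {G T : Type*} [AddCommGroup G] [DecidableEq T]
    {φ : G →+ (T → ℚ)} {g : G} {i : T}
    (hg : ∀ j, j ≠ i → φ g j = 0) : g ∈ pureSum φ := by
  intro j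
  rcases eq_or_ne j i with rfl | hj
  · refine ⟨g, ?_⟩
    ext l
    rcases eq_or_ne l j with rfl | hl
    · simp
    · simp [hl, hg l hl]
  · exact ⟨0, by simp [hg j hj]⟩

namespace IsCoordinates

variable {G : Type*} [AddCommGroup G] {T : Type*} [Finite T] [DecidableEq T]
  {t : T → GType} {e : T → G} {A : AddSubgroup G} {φ : G →+ (T → ℚ)}

/-- The summands are the coordinate axes in G; evaluating the one surviving coordinate embeds each
of them in ℚ. -/
theorem isCD_pureSum (h : IsCoordinates t e A φ) : IsCD (pureSum φ) := by
  classical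
  have := Fintype.ofFinite T
  let E := Fintype.equivFin T
  let S : T → AddSubgroup (pureSum φ) := fun i =>
    { carrier := {g | ∀ j, j ≠ i → φ g j = 0}
      zero_mem' := fun j _ => by simp
      add_mem' := fun {a b} ha hb j hj => by simp [ha j hj, hb j hj]
      neg_mem' := fun {a} ha j hj => by simp [ha j hj] }
  refine ⟨⟨Fintype.card T, fun k => S (E.symm k), ⟨?_, ?_⟩, fun k => ?_⟩⟩
  · rw [injective_iff_map_eq_zero]
    intro x hx
    rw [DirectSum.coeAddMonoidHom_eq_dfinsuppSum,
      DFinsupp.sum_eq_sum_fintype _ (by simp)] at hx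
    ext k
    refine congrArg Subtype.val (?_ : (x k : pureSum φ) = 0) |>.trans rfl
    apply Subtype.ext
    apply h.injective
    ext j
    rcases eq_or_ne j (E.symm k) with rfl | hj
    · have := congrFun (congrArg (fun y : pureSum φ => φ y) hx) (E.symm k)
      simp only [AddSubgroup.coe_zero, map_zero, Pi.zero_apply, AddSubgroup.val_finsetSum,
        map_sum, Finset.sum_apply] at this
      rw [Finset.sum_eq_single k] at this
      · simpa using this
      · intro l _ hl
        exact (x l).2 _ (fun hc => hl (E.symm.injective hc).symm)
      · simp
    · simpa using (x k).2 j hj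
  · intro g
    choose x hx using g.2
    have hx' : ∀ i, x i ∈ pureSum φ := fun i =>
      mem_pureSum_of_supported (i := i) fun j hj => by simp [hx, hj]
    refine ⟨∑ k, DirectSum.of (fun k => S (E.symm k)) k ⟨⟨x (E.symm k), hx' _⟩,
      fun j hj => by simp [hx, hj]⟩, ?_⟩
    rw [map_sum]
    simp only [DirectSum.coeAddMonoidHom_of]
    apply Subtype.ext
    apply h.injective
    ext j
    rw [AddSubgroup.val_finsetSum, map_sum, Finset.sum_apply,
      Finset.sum_eq_single (E j) (fun k _ hk => ?_) (by simp)]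
    · simp [hx]
    · have : j ≠ E.symm k := fun hc => hk (by simp [hc])
      simp [hx, this]
  · let f : S (E.symm k) →+ ℚ := ((Pi.evalAddMonoidHom (fun _ : T => ℚ) (E.symm k)).comp φ).comp
      ((pureSum φ).subtype.comp (S (E.symm k)).subtype)
    have hf : ∀ x, f x = φ x (E.symm k) := fun _ => rfl
    have he : ∀ j, j ≠ E.symm k → φ (e (E.symm k)) j = 0 := fun j hj => by
      simp [h.map_basis, hj]
    refine isRankOne_of_injective f ?_
      (x := ⟨⟨e (E.symm k), mem_pureSum_of_supported he⟩, he⟩) ?_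
    · rw [injective_iff_map_eq_zero]
      intro x hx
      apply Subtype.ext
      apply Subtype.ext
      apply h.injective
      ext j
      rcases eq_or_ne j (E.symm k) with rfl | hj
      · simpa [hf] using hx
      · simpa using x.2 j hj
    · intro hc
      have := congrArg f hc
      simp [hf, h.map_basis] at this

/-- If the types are incomparable, each rank one summand of a completely decomposable subgroup of
bounded index is contained in the pure hull of an element of the basis. -/
theorem exists_supported_of_summand (h : IsCoordinates t e A φ)
    (ht : ∀ i j, (t i).PInf ⊆ (t j).PInf → i = j) {H : AddSubgroup G}
    (hH : ∃ N : ℕ, N ≠ 0 ∧ ∀ g : G, N • g ∈ H) (D : CompleteDecomposition H) (k : Fin D.k) :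
    ∃ i, ∀ x ∈ D.summand k, ∀ j, j ≠ i → φ x j = 0 := by
  have := Fintype.ofFinite T
  obtain ⟨N, hN0, hN⟩ := hH
  obtain ⟨π, hπ, hπ', -, -⟩ := D.exists_projections
  -- Multiplication by N followed by the projection onto the summand is an endomorphism of all of G,
  -- so it is diagonal.
  let f : G →+ G := H.subtype.comp
    ((π k).comp ((nsmulAddMonoidHom N).codRestrict H hN))
  have hf : ∀ g, f g = π k ⟨N • g, hN g⟩ := fun g => rfl
  obtain ⟨⟨x, hx⟩, hx0⟩ := (D.rankOne k).exists_ne_zero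
  have hx0 : (x : G) ≠ 0 := fun hc => hx0 (Subtype.ext (Subtype.ext hc))
  have hfx : f x = N • (x : G) := by
    have : (⟨N • (x : G), hN x⟩ : H) = N • x := rfl
    rw [hf, this, map_nsmul, hπ' k x hx]
    rfl
  have hfx0 : φ (f x) ≠ 0 := by
    rw [hfx, map_nsmul]
    exact smul_ne_zero hN0 fun hc => hx0 (h.injective (hc.trans (map_zero φ).symm))
  obtain ⟨i, hi⟩ := Function.ne_iff.1 hfx0
  rw [h.map_apply ht] at hi
  -- Thus f(e_i) is a nonzero element of the summand, and it lies on the i-th axis; rank one then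
  -- drags the whole summand onto that axis.
  have hi : φ (f (e i)) i ≠ 0 := left_ne_zero_of_mul hi
  have hxi : f (e i) ≠ 0 := fun hc => hi (by simp [hc])
  refine ⟨i, fun y hy j hj => ?_⟩
  have hfe : φ (f (e i)) j = 0 := by rw [h.map_apply ht, h.map_basis]; simp [hj]
  obtain ⟨n, l, hn, hnl⟩ := (D.rankOne k).exists_zsmul_eq
    (x := ⟨π k ⟨N • e i, hN _⟩, hπ _ _⟩)
    (fun hc => hxi (congrArg (fun z : D.summand k => ((z : H) : G)) hc)) ⟨y, hy⟩
  have := congrFun (congrArg φ (congrArg (fun z : D.summand k => ((z : H) : G)) hnl)) j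
  have h2 : n • φ (y : G) j = l • φ (f (e i)) j := by
    rw [hf]
    simpa only [AddSubgroup.coe_zsmul, map_zsmul, Pi.smul_apply] using this
  rw [hfe, smul_zero] at h2
  exact (smul_eq_zero.1 h2).resolve_left hn

theorem le_pureSum (h : IsCoordinates t e A φ)
    (ht : ∀ i j, (t i).PInf ⊆ (t j).PInf → i = j) {H : AddSubgroup G}
    (hH : H.FiniteIndex) (hcd : IsCD H) : H ≤ pureSum φ := by
  obtain ⟨D⟩ := hcd
  obtain ⟨π, hπ, -, -, hsum⟩ := D.exists_projections
  intro g hg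
  have := congrArg H.subtype (hsum ⟨g, hg⟩)
  rw [map_sum] at this
  change g = _ at this
  rw [this]
  refine sum_mem fun k _ => ?_
  obtain ⟨i, hi⟩ := h.exists_supported_of_summand ht
    ⟨H.index, hH.index_ne_zero, H.nsmul_index_mem⟩ D k
  exact mem_pureSum_of_supported (hi _ (hπ k _))

/-- The regulator contains the pure hulls of the elements of its basis. -/
theorem mem_regulator_of_supported (h : IsCoordinates t e (regulator G) φ)
    (ht : ∀ i j, (t i).PInf ⊆ (t j).PInf → i = j) {g : G} {i : T}
    (hg : ∀ j, j ≠ i → φ g j = 0) : g ∈ regulator G := by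
  rw [regulator, AddSubgroup.mem_sInf]
  intro H hH
  -- Least index of H against the completely decomposable group `pureSum φ` containing it forces
  -- equality.
  have hle := h.le_pureSum ht hH.2.1 hH.1
  have hfi := hH.2.1
  have hfi' : (pureSum φ).FiniteIndex := AddSubgroup.finiteIndex_of_le hle
  have hidx := hH.2.2 _ h.isCD_pureSum hfi'
  have hrel := AddSubgroup.relIndex_mul_index hle
  have : H.relIndex (pureSum φ) = 1 := by
    have h1 := hfi'.index_ne_zero
    have h2 : H.relIndex (pureSum φ) ≠ 0 := fun hc =>
      hfi.index_ne_zero (by rw [← hrel, hc, zero_mul])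
    rw [← hrel] at hidx
    have := Nat.le_of_mul_le_mul_right (hidx.trans_eq (one_mul _).symm) (Nat.pos_of_ne_zero h1)
    lia
  exact AddSubgroup.relIndex_eq_one.1 this (mem_pureSum_of_supported hg)

end IsCoordinates

/-! ### The homogeneous components of the regulator -/

theorem isCD_regulator_of_mem_critTypes {G : Type*} [AddCommGroup G] {τ : GType}
    (hτ : τ ∈ critTypes G) : IsCD (regulator G) := by
  by_contra h
  exact hτ (by rw [regPart, dif_neg h])

theorem regPart_le_regulator {G : Type*} [AddCommGroup G] (τ : GType) :
    regPart G τ ≤ regulator G := by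
  rw [regPart]
  split_ifs
  · rw [AddSubgroup.map_le_iff_le_comap]
    exact fun x _ => x.2
  · exact bot_le

/-- The component `Reg_τ G` is generated by elements of type `τ`. -/
theorem regPart_induction {G : Type*} [AddCommGroup G] {τ : GType} {p : G → Prop}
    (hp : ∀ g ∈ regulator G, IsDivisibleBy τ.PInf g → p g) (h0 : p 0)
    (hadd : ∀ x y, p x → p y → p (x + y)) {g : G} (hg : g ∈ regPart G τ) : p g := by
  rw [regPart] at hg
  split_ifs at hg with hcd
  · obtain ⟨x, hx, rfl⟩ := hg
    rw [SetLike.mem_coe, CompleteDecomposition.part] at hx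
    induction hx using AddSubgroup.iSup_induction' with
    | hp i x hx =>
      exact hp _ x.2 ((i.2.isDivisibleBy ⟨x, hx⟩).map
        ((regulator G).subtype.comp (AddSubgroup.subtype _)))
    | h1 => simpa using h0
    | hadd x y _ _ hx hy => simpa using hadd _ _ hx hy
  · rw [AddSubgroup.mem_bot] at hg
    rwa [hg]

/-- A direct summand of the regulator is pure in it: the projections onto the summands of other
types kill ng, hence g. -/
theorem mem_regPart_of_nsmul_mem {G : Type*} [AddCommGroup G] [IsAddTorsionFree G] {τ : GType}
    (hτ : τ ∈ critTypes G) {g : G} (hg : g ∈ regulator G) {n : ℤ} (hn : n ≠ 0)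
    (h : n • g ∈ regPart G τ) : g ∈ regPart G τ := by
  have hcd := isCD_regulator_of_mem_critTypes hτ
  rw [regPart, dif_pos hcd] at h ⊢
  set D := Classical.choice hcd
  obtain ⟨x, hx, hxg⟩ := h
  obtain ⟨π, hπ, -, hπ0, hsum⟩ := D.exists_projections
  have hker : ∀ k, ¬ HasType (D.summand k) τ → ∀ y ∈ D.part τ, π k y = 0 := by
    intro k hk y hy
    rw [CompleteDecomposition.part] at hy
    induction hy using AddSubgroup.iSup_induction' with
    | hp i y hy =>
      exact hπ0 i k (fun hc => hk (hc ▸ i.2)) y hy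
    | h1 => exact map_zero _
    | hadd y z _ _ hy hz => rw [map_add, hy, hz, add_zero]
  refine ⟨⟨g, hg⟩, ?_, rfl⟩
  have hx' : x = n • (⟨g, hg⟩ : regulator G) := Subtype.ext hxg
  rw [SetLike.mem_coe, hsum ⟨g, hg⟩]
  refine sum_mem fun k _ => ?_
  by_cases hk : HasType (D.summand k) τ
  · exact AddSubgroup.mem_iSup_of_mem (⟨k, hk⟩ : {i // HasType (D.summand i) τ}) (hπ k _)
  · have := hker k hk x hx
    rw [hx', map_zsmul] at this
    rw [(smul_eq_zero.1 this).resolve_left hn]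
    exact zero_mem _

/-! ### Multiplications in coordinates -/

/-- Coordinates of a group `G = ⟨d, A⟩` with respect to a basis of the subgroup `A`, where `A`
contains the pure hulls of the elements of the basis and the types are incomparable. -/
structure IsCyclicExtension {G : Type*} [AddCommGroup G] {T : Type*} [Finite T] [DecidableEq T]
    (t : T → GType) (e : T → G) (A : AddSubgroup G) (φ : G →+ (T → ℚ)) (d : G) (s m : T → ℤ) :
    Prop extends IsCoordinates t e A φ where
  eq_of_subset : ∀ i j, (t i).PInf ⊆ (t j).PInf → i = j
  mem_of_supported : ∀ g i, (∀ j, j ≠ i → φ g j = 0) → g ∈ A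
  m_ne_zero : ∀ i, m i ≠ 0
  coprime : ∀ i, IsCoprime (s i) (m i)
  map_generator : ∀ i, φ d i = s i / m i
  exists_sub_mem : ∀ g, ∃ k : ℤ, g - k • d ∈ A

namespace IsCyclicExtension

variable {G : Type*} [AddCommGroup G] {T : Type*} [Finite T] [DecidableEq T]
  {t : T → GType} {e : T → G} {A : AddSubgroup G} {φ : G →+ (T → ℚ)} {d : G} {s m : T → ℤ}

theorem exists_eq_add (h : IsCyclicExtension t e A φ d s m) (g : G) :
    ∃ k : ℤ, ∃ r : T → ℚ, (∀ i, r i ∈ (t i).R) ∧ ∀ i, φ g i = k * (s i / m i) + r i := by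
  obtain ⟨k, hk⟩ := h.exists_sub_mem g
  refine ⟨k, _, (h.mem_iff _).1 hk, fun i => ?_⟩
  simp [h.map_generator]

theorem exists_map_eq (h : IsCyclicExtension t e A φ d s m) {v : T → ℚ} (k : ℤ)
    (hv : ∀ i, v i - k * (s i / m i) ∈ (t i).R) : ∃ g, φ g = v := by
  obtain ⟨a, ha⟩ := h.exists_of_mem _ hv
  refine ⟨k • d + a, ?_⟩
  ext i
  simp [ha, h.map_generator]

theorem map_mem_R (h : IsCyclicExtension t e A φ d s m) {g : G} {i : T}
    (hg : ∀ j, j ≠ i → φ g j = 0) : φ g i ∈ (t i).R :=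
  (h.mem_iff _).1 (h.mem_of_supported g i hg) i

/-- The multipliers that define endomorphisms of `G`. -/
def IsMultiplier (t : T → GType) (m : T → ℤ) (c : T → ℚ) : Prop :=
  ∃ k : ℤ, ∀ i, ∃ r ∈ (t i).R, c i = k + m i * r

/-- Writing f(d) ∈ kd + A gives (c_i − k) s_i/m_i ∈ R_i, and s_i cancels by coprimality. -/
theorem isMultiplier_of_endomorphism (h : IsCyclicExtension t e A φ d s m) (f : G →+ G) :
    IsMultiplier t m fun i => φ (f (e i)) i := by
  obtain ⟨k, r, hr, hk⟩ := h.exists_eq_add (f d)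
  refine ⟨k, fun i => ⟨(φ (f (e i)) i - k) / m i, ?_, ?_⟩⟩
  · refine mem_of_coprime_mul_div_mem (h.coprime i) (h.m_ne_zero i) ?_ ?_
    · refine sub_mem (h.map_mem_R fun j hj => ?_) (intCast_mem _ k)
      rw [h.map_apply h.eq_of_subset, h.map_basis]
      simp [hj]
    · have := hk i
      rw [h.map_apply h.eq_of_subset, h.map_generator] at this
      convert hr i using 1
      linear_combination this
  · have : (m i : ℚ) ≠ 0 := by exact_mod_cast h.m_ne_zero i
    field_simp
    ring

theorem exists_endomorphism (h : IsCyclicExtension t e A φ d s m) {c : T → ℚ}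
    (hc : IsMultiplier t m c) : ∃ f : G →+ G, ∀ g, φ (f g) = c * φ g := by
  obtain ⟨k, hk⟩ := hc
  choose r hr hcr using hk
  have hex : ∀ g, ∃ x, φ x = c * φ g := by
    intro g
    obtain ⟨l, a, ha, hl⟩ := h.exists_eq_add g
    -- For g ∈ ld + A the image is congruent to kl·d modulo A.
    refine h.exists_map_eq (k * l) fun i => ?_
    have hm : (m i : ℚ) ≠ 0 := by exact_mod_cast h.m_ne_zero i
    have : (c * φ g) i - (k * l : ℤ) * (s i / m i) = l * s i * r i + (k + m i * r i) * a i := by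
      rw [Pi.mul_apply, hl, hcr]
      push_cast
      field_simp
      ring
    rw [this]
    exact add_mem (mul_mem (mul_mem (intCast_mem _ _) (intCast_mem _ _)) (hr i))
      (mul_mem (add_mem (intCast_mem _ _) (mul_mem (intCast_mem _ _) (hr i))) (ha i))
  choose f hf using hex
  exact ⟨AddMonoidHom.mk' f fun x y => h.injective (by simp [hf, mul_add]), hf⟩

/-- With one factor fixed, a multiplication is an endomorphism of G, hence diagonal; this is applied
to each factor in turn. -/
theorem mult_apply (h : IsCyclicExtension t e A φ d s m) (μ : Mult G) (x y : G) (i : T) :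
    φ (μ (x ⊗ₜ y)) i = φ (μ (e i ⊗ₜ e i)) i * φ x i * φ y i := by
  have h1 := h.map_apply h.eq_of_subset
    (μ.toAddMonoidHom.comp ((TensorProduct.mk ℤ G G).flip y).toAddMonoidHom) x i
  have h2 := h.map_apply h.eq_of_subset
    (μ.toAddMonoidHom.comp (TensorProduct.mk ℤ G G (e i)).toAddMonoidHom) y i
  change φ (μ (x ⊗ₜ y)) i = φ (μ (e i ⊗ₜ y)) i * φ x i at h1
  change φ (μ (e i ⊗ₜ y)) i = φ (μ (e i ⊗ₜ e i)) i * φ y i at h2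
  rw [h1, h2]
  ring

theorem mult_basis_supported (h : IsCyclicExtension t e A φ d s m) (μ : Mult G) (i j : T)
    (hj : j ≠ i) : φ (μ (e i ⊗ₜ e i)) j = 0 := by
  rw [h.mult_apply, h.map_basis]
  simp [hj]

theorem mult_ext (h : IsCyclicExtension t e A φ d s m) {μ ν : Mult G}
    (hμν : ∀ i, μ (e i ⊗ₜ e i) = ν (e i ⊗ₜ e i)) : μ = ν := by
  refine TensorProduct.ext' fun x y => h.injective ?_
  ext i
  have h1 := h.mult_apply μ x y i
  rw [hμν i] at h1
  exact h1.trans (h.mult_apply ν x y i).symm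

theorem exists_mult (h : IsCyclicExtension t e A φ d s m) {u : T → ℚ} {w : T → ℤ}
    (hw : ∀ i, m i ∣ s i * w i - 1) (k : ℤ)
    (hu : ∀ i, ∃ r ∈ (t i).R, u i = m i * (k * w i + m i * r)) :
    ∃ μ : Mult G, ∀ x y, φ (μ (x ⊗ₜ y)) = u * φ x * φ y := by
  choose r hr hur using hu
  choose z hz using hw
  have hex : ∀ x y, ∃ g, φ g = u * φ x * φ y := by
    intro x y
    obtain ⟨l, a, ha, hl⟩ := h.exists_eq_add x
    obtain ⟨n, b, hb, hn⟩ := h.exists_eq_add y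
    -- Modulo R_i the product is l n (k w + m r) s²/m, which reduces to l n k · s/m since s w ≡ 1
    -- modulo m.
    refine h.exists_map_eq (l * n * k) fun i => ?_
    have hm : (m i : ℚ) ≠ 0 := by exact_mod_cast h.m_ne_zero i
    have hzi : (s i : ℚ) * w i - 1 = m i * z i := by exact_mod_cast hz i
    have : (u * φ x * φ y) i - (l * n * k : ℤ) * (s i / m i) =
        (l * n * k * z i * s i : ℤ) + (l * n * s i ^ 2 : ℤ) * r i +
        ((k * w i : ℤ) + m i * r i) * s i * (l * b i + n * a i) +
        m i * ((k * w i : ℤ) + m i * r i) * a i * b i := by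
      simp only [Pi.mul_apply]
      rw [hl, hn, hur]
      push_cast
      field_simp
      linear_combination (l * n * k * s i : ℚ) * hzi
    rw [this]
    have hI : ∀ n : ℤ, (n : ℚ) ∈ (t i).R := fun n => intCast_mem _ n
    have hv : ((k * w i : ℤ) : ℚ) + m i * r i ∈ (t i).R :=
      add_mem (hI _) (mul_mem (hI _) (hr i))
    exact add_mem (add_mem (add_mem (hI _) (mul_mem (hI _) (hr i)))
      (mul_mem (mul_mem hv (hI _)) (add_mem (mul_mem (hI _) (hb i)) (mul_mem (hI _) (ha i)))))
      (mul_mem (mul_mem (mul_mem (hI _) hv) (ha i)) (hb i))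
  choose f hf using hex
  refine ⟨TensorProduct.lift (LinearMap.mk₂ ℤ f ?_ ?_ ?_ ?_), hf⟩
  · intro x y z; apply h.injective; simp only [hf, map_add]; ring
  · intro c x y; apply h.injective; simp [hf]; ring
  · intro x y z; apply h.injective; simp only [hf, map_add]; ring
  · intro c x y; apply h.injective; simp [hf]; ring

theorem mult_basis_eq (h : IsCyclicExtension t e A φ d s m) {w : T → ℤ}
    (hw : ∀ i, m i ∣ s i * w i - 1) (μ : Mult G) :
    ∃ k : ℤ, ∀ i, ∃ r ∈ (t i).R, φ (μ (e i ⊗ₜ e i)) i = m i * (k * w i + m i * r) := by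
  obtain ⟨k, r, hr, hk⟩ := h.exists_eq_add (μ (d ⊗ₜ d))
  refine ⟨k, fun i => ?_⟩
  obtain ⟨z, hz⟩ := hw i
  have hz : (s i : ℚ) * w i - 1 = m i * z := by exact_mod_cast hz
  have hm : (m i : ℚ) ≠ 0 := by exact_mod_cast h.m_ne_zero i
  have hI : ∀ n : ℤ, (n : ℚ) ∈ (t i).R := fun n => intCast_mem _ n
  have hki := hk i
  rw [h.mult_apply, h.map_generator] at hki
  have hu := h.map_mem_R (h.mult_basis_supported μ i)
  -- The product d × e_i lies on the i-th axis, hence in A; this yields the first division of u by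
  -- m.
  have hdu : φ (μ (d ⊗ₜ e i)) i ∈ (t i).R := h.map_mem_R fun j hj => by
    rw [h.mult_apply, h.map_basis]
    simp [hj]
  rw [h.mult_apply, h.map_generator, h.map_basis, Pi.single_eq_same, mul_one] at hdu
  set u := φ (μ (e i ⊗ₜ e i)) i
  have hv : u / m i ∈ (t i).R := mem_of_coprime_mul_div_mem (h.coprime i) (h.m_ne_zero i) hu hdu
  have hx : s i * (u / m i) - k ∈ (t i).R := sub_mem (mul_mem (hI _) hv) (hI _)
  -- The second division comes from d × d ∈ kd + A, which is where the k common to all i arises.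
  have hxm : (s i * (u / m i) - k) / m i ∈ (t i).R := by
    refine mem_of_coprime_mul_div_mem (h.coprime i) (h.m_ne_zero i) hx ?_
    convert hr i using 1
    linear_combination hki
  -- With v = u/m and s w = 1 + m z, one has v − k w = w (s v − k) − m z v; the witness is this
  -- divided by m.
  refine ⟨w i * ((s i * (u / m i) - k) / m i) - z * (u / m i),
    sub_mem (mul_mem (hI _) hxm) (mul_mem (hI _) hv), ?_⟩
  field_simp
  linear_combination (-u) * hz

theorem ringsIsomorphic_iff (h : IsCyclicExtension t e A φ d s m) (μ ν : Mult G) :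
    RingsIsomorphic μ ν ↔ ∃ c c' : T → ℚ, IsMultiplier t m c ∧ IsMultiplier t m c' ∧ c * c' = 1 ∧
      ∀ i, φ (μ (e i ⊗ₜ e i)) i = c i * φ (ν (e i ⊗ₜ e i)) i := by
  constructor
  · rintro ⟨f, hf⟩
    have hc : ∀ i, φ (f (e i)) i * φ (f.symm (e i)) i = 1 := fun i => by
      have := h.map_apply h.eq_of_subset f.toAddMonoidHom (f.symm (e i)) i
      simpa [h.map_basis] using this.symm
    refine ⟨_, _, h.isMultiplier_of_endomorphism f.toAddMonoidHom,
      h.isMultiplier_of_endomorphism f.symm.toAddMonoidHom, funext hc, fun i => ?_⟩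
    have h1 := congrFun (congrArg φ (hf (e i) (e i))) i
    have h2 := h.map_apply h.eq_of_subset f.toAddMonoidHom (μ (e i ⊗ₜ e i)) i
    change φ (f (μ (e i ⊗ₜ e i))) i = φ (f (e i)) i * φ (μ (e i ⊗ₜ e i)) i at h2
    rw [h2, h.mult_apply ν (f (e i))] at h1
    apply mul_left_cancel₀ (left_ne_zero_of_mul_eq_one (hc i))
    rw [h1]
    change _ = _ * (φ (f (e i)) i * _)
    ring
  · rintro ⟨c, c', hc, hc', hcc, hu⟩
    obtain ⟨f, hf⟩ := h.exists_endomorphism hc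
    obtain ⟨f', hf'⟩ := h.exists_endomorphism hc'
    refine ⟨{ f with
      invFun := f'
      left_inv := fun g => h.injective ?_
      right_inv := fun g => h.injective ?_ }, fun x y => h.injective ?_⟩
    · change φ (f' (f g)) = φ g
      rw [hf', hf, ← mul_assoc, mul_comm c', hcc, one_mul]
    · change φ (f (f' g)) = φ g
      rw [hf, hf', ← mul_assoc, hcc, one_mul]
    · change φ (f (μ (x ⊗ₜ y))) = φ (ν (f x ⊗ₜ f y))
      ext i
      rw [hf, Pi.mul_apply, h.mult_apply μ, h.mult_apply ν, hu, hf, hf, Pi.mul_apply, Pi.mul_apply]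
      ring

end IsCyclicExtension

/-! ### The regulator of a rigid group -/

section Regulator

variable {G : Type*} [AddCommGroup G] {e : critTypes G → G} {e₀ : critTypes₀ G → G}

/-- Zero elements contribute nothing to the sum, so coordinates exist on the nonzero ones alone. If
e_τ = 0, an element divisible by P_∞(τ) has no coordinate left to be nonzero in, so Reg_τ G would
vanish, although τ is critical. -/
theorem IsRBasis.ne_zero (hG : InA0 G) (he : IsRBasis e e₀) (τ : critTypes G) : e τ ≠ 0 := by
  classical
  intro hτ
  have := hG.crq.1.torsionFree
  have := (critTypes_finite G).to_subtype
  obtain ⟨φ, hφ⟩ := exists_isCoordinates (fun σ : {σ : critTypes G // e σ ≠ 0} => (σ : GType))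
    (fun σ => e σ) (regulator G) (fun σ => σ.2) (he.independent.comp Subtype.val_injective)
    (by
      rw [← he.sum_eq]
      refine le_antisymm (iSup_le fun σ => le_iSup (fun τ : critTypes G => cyc (τ : GType) (e τ)) σ)
        (iSup_le fun σ => ?_)
      by_cases hσ : e σ = 0
      · rintro x hx
        obtain ⟨r, -, rfl⟩ := mem_cyc.1 hx
        simp [hσ]
      · exact le_iSup (fun τ : {σ : critTypes G // e σ ≠ 0} => cyc (τ : GType) (e τ)) ⟨σ, hσ⟩)
    hG.crq.1.exists_nsmul_mem_regulator
  refine τ.2 ((AddSubgroup.eq_bot_iff_forall _).2 fun g hg => ?_)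
  refine regPart_induction (p := fun g : G => g = 0) (fun g _ hg => ?_) rfl (fun x y hx hy => ?_) hg
  · apply hφ.injective
    ext σ
    by_contra hc
    have hc : φ g σ ≠ 0 := by simpa using hc
    have := eq_of_pInf_subset hG.blockRigid hG.ringType (hφ.pInf_subset hg hc)
    exact σ.2 (this ▸ hτ)
  · rw [hx, hy, add_zero]

theorem IsRBasis.exists_isCoordinates [Finite (critTypes G)] [DecidableEq (critTypes G)]
    (hG : InA0 G) (he : IsRBasis e e₀) :
    ∃ φ, IsCoordinates (fun τ : critTypes G => (τ : GType)) e (regulator G) φ :=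
  have := hG.crq.1.torsionFree
  ACDGroup.exists_isCoordinates _ _ _ (he.ne_zero hG) he.independent he.sum_eq
    hG.crq.1.exists_nsmul_mem_regulator

/-- This frees `regPart` from the chosen decomposition. Divisibility puts it on the axis;
conversely, a point of the axis has a nonzero multiple in ℤe_τ, and purity applies. -/
theorem IsRBasis.mem_regPart_iff [Finite (critTypes G)] [DecidableEq (critTypes G)]
    (hG : InA0 G) (he : IsRBasis e e₀) {φ : G →+ (critTypes G → ℚ)}
    (hφ : IsCoordinates (fun τ : critTypes G => (τ : GType)) e (regulator G) φ)
    {τ : critTypes G} {g : G} : g ∈ regPart G τ ↔ ∀ σ, σ ≠ τ → φ g σ = 0 := by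
  have := hG.crq.1.torsionFree
  have := Fintype.ofFinite (critTypes G)
  have ht := fun σ τ : critTypes G => eq_of_pInf_subset hG.blockRigid hG.ringType (τ := σ) (σ := τ)
  refine ⟨fun hg => ?_, fun hg => ?_⟩
  · refine regPart_induction (p := fun g : G => ∀ σ, σ ≠ τ → φ g σ = 0)
      (fun g _ hg σ hσ => ?_) (fun σ _ => by simp) (fun x y hx hy σ hσ => by simp [hx σ hσ, hy σ hσ]) hg
    by_contra hc
    exact hσ (ht _ _ (hφ.pInf_subset hg hc)).symm
  · obtain ⟨n, hn, k, hk⟩ := hφ.exists_zsmul_eq_sum g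
    refine mem_regPart_of_nsmul_mem τ.2 (hφ.mem_regulator_of_supported ht hg) hn ?_
    rw [hk]
    refine sum_mem fun σ _ => ?_
    rcases eq_or_ne σ τ with rfl | hσ
    · exact zsmul_mem (he.mem_part σ) _
    · have := congrFun (congrArg φ hk) σ
      simp only [map_zsmul, map_sum, hφ.map_basis, Finset.sum_apply, Pi.smul_apply, hg σ hσ] at this
      rw [Finset.sum_eq_single σ (fun j _ hj => by simp [hj.symm]) (by simp)] at this
      have : k σ = 0 := by simpa using this.symm
      simp [this]

theorem IsRBasis.proj_mem (he : IsRBasis e e₀) (τ : critTypes G) {x : Hull G}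
    (hx : x ∈ (regulator G).map (toHull G)) : proj G τ x ∈ (regulator G).map (toHull G) := by
  rw [proj]
  split_ifs with hc
  · have hle : ∀ σ : critTypes G, ∀ y ∈ cyc (σ : GType) (e σ), y ∈ hullPart G σ := by
      rintro σ y hy
      obtain ⟨r, -, rfl⟩ := mem_cyc.1 hy
      exact Submodule.smul_mem _ _ (Submodule.subset_span ⟨_, he.mem_part σ, rfl⟩)
    rw [← he.sum_eq] at hx ⊢
    induction hx using AddSubgroup.iSup_induction' with
    | hp σ y hy =>
      rcases eq_or_ne σ τ with rfl | hσ
      · rw [Submodule.projection_apply_of_mem_left hc (hle σ y hy)]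
        exact AddSubgroup.mem_iSup_of_mem σ hy
      · have hmem : y ∈ ⨆ σ ∈ critTypes G \ {(τ : GType)}, hullPart G σ := by
          refine Submodule.mem_iSup_of_mem (σ : GType) (Submodule.mem_iSup_of_mem ?_ (hle σ y hy))
          exact ⟨σ.2, fun h => hσ (Subtype.ext h)⟩
        rw [Submodule.projection_apply_of_mem_right hc hmem]
        exact zero_mem _
    | h1 => rw [map_zero]; exact zero_mem _
    | hadd y z _ _ hy hz => rw [map_add]; exact add_mem hy hz
  -- Here `proj` takes its default value 0.
  · exact zero_mem _

/-- Rules out the default values of `mInv`: a missing generator or an element of infinite order. -/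
theorem IsRBasis.mInv_ne_zero (hG : InA0 G) (he : IsRBasis e e₀) {d : G} (hd : IsRegGenerator d)
    (τ : critTypes G) : mInv G τ ≠ 0 := by
  have hex : ∃ d : G, IsRegGenerator d := ⟨d, hd⟩
  obtain ⟨N, hN0, hN⟩ := hG.crq.1.exists_nsmul_mem_regulator
  rw [mInv, dif_pos hex]
  refine (IsOfFinAddOrder.addOrderOf_pos ?_).ne'
  refine isOfFinAddOrder_iff_nsmul_eq_zero.2 ⟨N, Nat.pos_of_ne_zero hN0, ?_⟩
  rw [← QuotientAddGroup.mk_nsmul, QuotientAddGroup.eq_zero_iff, ← map_nsmul, ← map_nsmul]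
  exact he.proj_mem τ ⟨_, hN _, rfl⟩

end Regulator

/-! ### The group `M_G(E₀)` and the ring `K_G` in coordinates -/

section Rigid

variable {G : Type*} [AddCommGroup G] {e : critTypes G → G} {e₀ : critTypes₀ G → G}
  {s : critTypes₀ G → ℤ}

open Classical in
/-- The numerators `s_τ`, extended by `0` to all critical types. -/
noncomputable def extNum (s : critTypes₀ G → ℤ) (τ : critTypes G) : ℤ :=
  if h : (τ : GType) ∈ critTypes₀ G then s ⟨τ, h⟩ else 0

open Classical in
/-- The inverses `s_τ⁻¹`, extended by `0` to all critical types. -/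
noncomputable def extInv (s : critTypes₀ G → ℤ) (τ : critTypes G) : ℤ :=
  if h : (τ : GType) ∈ critTypes₀ G then
    (((s ⟨τ, h⟩ : ZMod (mInv G τ))⁻¹).val : ℤ) else 0

theorem mInv_eq_one {τ : critTypes G} (hm : mInv G τ ≠ 0) (hτ : (τ : GType) ∉ critTypes₀ G) :
    mInv G τ = 1 := by
  by_contra h
  exact hτ ⟨τ.2, by lia⟩

/-- Outside T₀ the modulus is 1, so the extension of s and s⁻¹ by 0 is harmless. -/
theorem dvd_extNum_mul_extInv_sub_one {G₁ : AddSubgroup G} {d : G} (he₀ : IsRCBasis G₁ d e₀ s)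
    (hm : ∀ τ : critTypes G, mInv G τ ≠ 0) (τ : critTypes G) :
    (mInv G τ : ℤ) ∣ extNum s τ * extInv s τ - 1 := by
  by_cases h : (τ : GType) ∈ critTypes₀ G
  · have : NeZero (mInv G τ) := ⟨hm τ⟩
    rw [extNum, extInv, dif_pos h, dif_pos h, ← ZMod.intCast_zmod_eq_zero_iff_dvd]
    push_cast
    rw [ZMod.natCast_zmod_val, ZMod.coe_int_mul_inv_eq_one, sub_self]
    exact he₀.coprime ⟨τ, h⟩
  · rw [mInv_eq_one (hm τ) h]
    simp

theorem IsRBasis.isCyclicExtension [Finite (critTypes G)] [DecidableEq (critTypes G)]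
    (hG : InA0 G) (he : IsRBasis e e₀) {G₁ : AddSubgroup G} {d : G}
    (he₀ : IsRCBasis G₁ d e₀ s) {φ : G →+ (critTypes G → ℚ)}
    (hφ : IsCoordinates (fun τ : critTypes G => (τ : GType)) e (regulator G) φ) :
    IsCyclicExtension (fun τ : critTypes G => (τ : GType)) e (regulator G) φ d (extNum s)
      (fun τ => (mInv G τ : ℤ)) := by
  have := hG.crq.1.torsionFree
  have := Fintype.ofFinite (critTypes G)
  have hm := he.mInv_ne_zero hG he₀.generator
  have ht := fun σ τ : critTypes G => eq_of_pInf_subset hG.blockRigid hG.ringType (τ := σ) (σ := τ)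
  refine { hφ with
    eq_of_subset := ht
    mem_of_supported := fun g i hg => hφ.mem_regulator_of_supported ht hg
    m_ne_zero := fun i => by exact_mod_cast hm i
    coprime := fun τ => ?_
    map_generator := fun τ => ?_
    exists_sub_mem := fun g => ?_ }
  · by_cases h : (τ : GType) ∈ critTypes₀ G
    · rw [extNum, dif_pos h]
      exact he₀.coprime ⟨τ, h⟩
    · rw [mInv_eq_one (hm τ) h]
      exact isCoprime_one_right
  · classical
    have hfin : Finite (critTypes₀ G) := ((critTypes_finite G).subset fun _ h => h.1).to_subtype
    have := Fintype.ofFinite (critTypes₀ G)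
    obtain ⟨Φ, hΦ⟩ := hφ.exists_linearMap
    have he₀Φ : ∀ σ : critTypes₀ G, Φ (toHull G (e₀ σ)) = Pi.single ⟨σ, σ.2.1⟩ 1 := fun σ => by
      rw [← hΦ, ← he.extends_rc, hφ.map_basis]
    -- The standard representation is an identity in the hull, so the coordinates of d are computed
    -- through the linear extension of `φ`.
    rw [hΦ, he₀.standard_rep, finsum_eq_sum_of_fintype, map_sum, Finset.sum_apply]
    simp only [map_smul, he₀Φ, Pi.smul_apply]
    by_cases h : (τ : GType) ∈ critTypes₀ G
    · rw [Finset.sum_eq_single ⟨τ, h⟩ (fun σ _ hσ => ?_) (by simp), extNum, dif_pos h]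
      · simp
      · have hne : τ ≠ ⟨σ, σ.2.1⟩ := fun hc => hσ (Subtype.ext (congrArg Subtype.val hc).symm)
        rw [Pi.single_eq_of_ne hne, smul_zero]
    · rw [Finset.sum_eq_zero fun σ _ => ?_, extNum, dif_neg h]
      · simp
      · have hne : τ ≠ ⟨σ, σ.2.1⟩ := by
          rintro rfl
          exact h σ.2
        rw [Pi.single_eq_of_ne hne, smul_zero]
  · have hg : g ∈ AddSubgroup.zmultiples d ⊔ regulator G := by
      rw [he₀.generator]; trivial
    obtain ⟨_, ⟨k, rfl⟩, a, ha, rfl⟩ := AddSubgroup.mem_sup.1 hg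
    exact ⟨k, by simpa using ha⟩

variable [Finite (critTypes G)] [DecidableEq (critTypes G)] {φ : G →+ (critTypes G → ℚ)}

theorem IsRBasis.map_elemX (he : IsRBasis e e₀)
    (hφ : IsCoordinates (fun τ : critTypes G => (τ : GType)) e (regulator G) φ)
    (τ : critTypes G) : φ (elemX e₀ s τ) = Pi.single τ (mInv G τ * extInv s τ : ℚ) := by
  rw [elemX, extInv]
  split_ifs with h
  · rw [← he.extends_rc, map_nsmul, hφ.map_basis, ← Pi.single_smul]
    simp
  · simp

/-- Puts M_G(E₀) in the shape produced by `mult_basis_eq` and consumed by `exists_mult`. -/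
theorem IsRBasis.mem_groupM_iff (hG : InA0 G) (he : IsRBasis e e₀)
    (hφ : IsCoordinates (fun τ : critTypes G => (τ : GType)) e (regulator G) φ)
    {U : critTypes G → G} : U ∈ groupM e₀ s ↔ ∃ k : ℤ, ∀ τ : critTypes G, ∃ r ∈ (τ : GType).R,
      φ (U τ) = Pi.single τ ((mInv G τ : ℤ) * (k * extInv s τ + (mInv G τ : ℤ) * r) : ℚ) := by
  constructor
  · intro hU
    obtain ⟨_, ⟨k, rfl⟩, Y, hY, rfl⟩ := AddSubgroup.mem_sup.1 hU
    refine ⟨k, fun τ => ?_⟩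
    obtain ⟨y, hy, hyY⟩ := hY τ trivial
    refine ⟨φ y τ, (hφ.mem_iff _).1 (regPart_le_regulator _ hy) τ, ?_⟩
    have hy' := (he.mem_regPart_iff hG hφ).1 hy
    change φ (k • elemX e₀ s τ + Y τ) = _
    rw [← hyY, map_add, map_zsmul, he.map_elemX hφ]
    ext σ
    rcases eq_or_ne σ τ with rfl | hσ
    · simp
      ring
    · simp [hσ, hy' σ hσ]
  · rintro ⟨k, hk⟩
    choose r hr hU using hk
    refine AddSubgroup.mem_sup.2 ⟨_, ⟨k, rfl⟩, U - k • elemX e₀ s, fun τ _ => ?_,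
      add_sub_cancel _ _⟩
    obtain ⟨g, hg⟩ := hφ.exists_of_mem (Pi.single τ (r τ)) fun σ => by
      rcases eq_or_ne σ τ with rfl | hσ
      · simpa using hr σ
      · simp [hσ]
    refine ⟨g, (he.mem_regPart_iff hG hφ).2 fun σ hσ => by simp [hg, hσ], hφ.injective ?_⟩
    change φ (mInv G τ ^ 2 • g) = φ (U τ - k • elemX e₀ s τ)
    rw [map_sub, map_nsmul, map_zsmul, hg, hU, he.map_elemX hφ]
    ext σ
    rcases eq_or_ne σ τ with rfl | hσ
    · simp
      ring
    · simp [hσ]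

omit [Finite (critTypes G)] [DecidableEq (critTypes G)] in
theorem mem_ringK_iff_isMultiplier (hm : ∀ τ : critTypes G, mInv G τ ≠ 0) {c : RingR G} :
    c ∈ ringK G ↔ IsCyclicExtension.IsMultiplier (fun τ : critTypes G => (τ : GType))
      (fun τ => (mInv G τ : ℤ)) (fun τ => (c τ : ℚ)) := by
  constructor
  · intro hc
    obtain ⟨_, ⟨k, rfl⟩, y, hy, rfl⟩ := AddSubgroup.mem_sup.1 hc
    refine ⟨k, fun τ => ?_⟩
    obtain ⟨r, hr⟩ := hy τ trivial
    have hr : (mInv G τ : ℚ) * r = y τ := by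
      rw [← hr]; simp
    by_cases hτ : (τ : GType) ∈ critTypes₀ G
    · refine ⟨r, r.2, ?_⟩
      simp [oneT₀, hτ, ← hr]
    -- Outside T₀ one has m_τ = 1, so the integer k is absorbed into R_τ and replacing 1 by 1_{T₀}
    -- changes nothing.
    · refine ⟨r - k, sub_mem r.2 (intCast_mem _ k), ?_⟩
      simp [oneT₀, hτ, ← hr, mInv_eq_one (hm τ) hτ]
  · rintro ⟨k, hk⟩
    choose r hr hc using hk
    refine AddSubgroup.mem_sup.2 ⟨_, ⟨k, rfl⟩, c - k • oneT₀ G, fun τ _ => ?_,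
      add_sub_cancel _ _⟩
    by_cases hτ : (τ : GType) ∈ critTypes₀ G
    · refine ⟨⟨r τ, hr τ⟩, Subtype.ext ?_⟩
      simp [oneT₀, hτ, hc]
    · refine ⟨c τ, Subtype.ext ?_⟩
      simp [oneT₀, hτ, mInv_eq_one (hm τ) hτ]

theorem toHull_eq_smul_iff (hG : InA0 G) (he : IsRBasis e e₀)
    (hφ : IsCoordinates (fun τ : critTypes G => (τ : GType)) e (regulator G) φ) {τ : critTypes G}
    {x y : G} (hx : ∀ σ, σ ≠ τ → φ x σ = 0) (hy : ∀ σ, σ ≠ τ → φ y σ = 0) (q : ℚ) :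
    toHull G x = q • toHull G y ↔ φ x τ = q * φ y τ := by
  have := hG.crq.1.torsionFree
  have key : ∀ x, (∀ σ, σ ≠ τ → φ x σ = 0) → toHull G x = φ x τ • toHull G (e τ) := fun x hx => by
    rw [hφ.toHull_eq]
    exact finsum_eq_single _ _ fun σ hσ => by rw [hx σ hσ, zero_smul]
  have hne : toHull G (e τ) ≠ 0 := fun h =>
    he.ne_zero hG τ (toHull_injective (h.trans (map_zero _).symm))
  rw [key x hx, key y hy, smul_smul]
  exact (smul_left_injective ℚ hne).eq_iff

end Rigid

end ACDGroup

/-! ### Assembly of the isomorphism theorem -/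

open ACDGroup
theorem theorem2p4 {G : Type*} [AddCommGroup G] (hG : InA0 G) (hrigid : IsRigid G)
    (G₁ C : AddSubgroup G) (hmain : IsMainDecomposition G₁ C)
    (d : G) (e₀ : critTypes₀ G → G) (s : critTypes₀ G → ℤ) (he₀ : IsRCBasis G₁ d e₀ s)
    (e : critTypes G → G) (he : IsRBasis e e₀) :
    (Function.Injective (multVector e) ∧ (multVector e).range = groupM e₀ s) ∧
    ∀ Ustar ∈ groupM e₀ s, ∀ Utimes ∈ groupM e₀ s, ∀ star times : Mult G,
      multVector e star = Ustar → multVector e times = Utimes →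
      (RingsIsomorphic star times ↔
        ∃ c ∈ unitsK G, ∀ τ : critTypes G,
          toHull G (Ustar τ) = (c τ : ℚ) • toHull G (Utimes τ)) := by
  classical
  have := (critTypes_finite G).to_subtype
  obtain ⟨φ, hφ⟩ := he.exists_isCoordinates hG
  have h := he.isCyclicExtension hG he₀ hφ
  have hm := he.mInv_ne_zero hG he₀.generator
  have hw := dvd_extNum_mul_extInv_sub_one he₀ hm
  refine ⟨⟨fun μ ν hμν => h.mult_ext fun τ => congrFun hμν τ, ?_⟩, ?_⟩
  · ext U
    rw [he.mem_groupM_iff hG hφ]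
    constructor
    · rintro ⟨μ, rfl⟩
      obtain ⟨k, hk⟩ := h.mult_basis_eq hw μ
      refine ⟨k, fun τ => ?_⟩
      obtain ⟨r, hr, hu⟩ := hk τ
      refine ⟨r, hr, ?_⟩
      rw [← hu]
      ext σ
      rcases eq_or_ne σ τ with rfl | hσ
      · simp [multVector]
      · rw [Pi.single_eq_of_ne hσ]
        exact h.mult_basis_supported μ τ σ hσ
    · rintro ⟨k, hk⟩
      choose r hr hU using hk
      obtain ⟨μ, hμ⟩ := h.exists_mult hw k fun τ => ⟨r τ, hr τ, rfl⟩
      refine ⟨μ, funext fun τ => h.injective ?_⟩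
      refine (hμ _ _).trans ?_
      rw [hU, h.map_basis]
      ext σ
      rcases eq_or_ne σ τ with rfl | hσ
      · simp
      · simp [hσ]
  · rintro _ - _ - μ ν rfl rfl
    -- Both products lie on the τ-axis, so the equation in the hull is one equation between rational
    -- coordinates.
    have hsm := fun (c : RingR G) τ => toHull_eq_smul_iff hG he hφ
      (h.mult_basis_supported μ τ) (h.mult_basis_supported ν τ) (c τ)
    rw [h.ringsIsomorphic_iff]
    constructor
    · rintro ⟨c, c', hc, hc', hcc, hu⟩
      have hR : ∀ {c}, IsCyclicExtension.IsMultiplier (fun τ : critTypes G => (τ : GType))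
          (fun τ => (mInv G τ : ℤ)) c → ∀ τ : critTypes G, c τ ∈ (τ : GType).R := by
        rintro c ⟨k, hk⟩ τ
        obtain ⟨r, hr, hcr⟩ := hk τ
        rw [hcr]
        exact add_mem (intCast_mem _ _) (mul_mem (intCast_mem _ _) hr)
      let a : RingR G := fun τ => ⟨c τ, hR hc τ⟩
      let a' : RingR G := fun τ => ⟨c' τ, hR hc' τ⟩
      have ha : a * a' = 1 := funext fun τ => Subtype.ext (congrFun hcc τ)
      exact ⟨a, ⟨(mem_ringK_iff_isMultiplier hm).2 hc, a', (mem_ringK_iff_isMultiplier hm).2 hc',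
        ha⟩, fun τ => (hsm a τ).2 (hu τ)⟩
    · rintro ⟨c, ⟨hc, c', hc', hcc⟩, hu⟩
      refine ⟨fun τ => c τ, fun τ => c' τ, (mem_ringK_iff_isMultiplier hm).1 hc,
        (mem_ringK_iff_isMultiplier hm).1 hc', ?_, fun τ => (hsm c τ).1 (hu τ)⟩
      funext τ
      have hτ : c τ * c' τ = 1 := congrFun hcc τ
      have hτ' : (c τ : ℚ) * (c' τ : ℚ) = 1 := by rw [← Subring.coe_mul, hτ, Subring.coe_one]
      exact hτ'
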